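/- Let $(\mathsf Z,\mathscr Z)$ be a measurable space, $N\ge 1$, $\beta\in(0,1)$, and for $i=1,\dots,N$ let $r_i:\mathsf Z\to\mathbb R$ be measurable and let $P_i$ be a stochastic kernel on $\mathsf Z$. In each period $t=0,1,2,\dots$ an agent observes the state $Z_t$ and chooses one of $N$ alternatives; choosing $i$ yields the current payoff $r_i(Z_t)$, and $Z_{t+1}$ is then drawn from $P_i(Z_t,\cdot)$. A plan $\sigma$ is a sequence of measurable maps $\sigma_t:\mathsf Z^{t+1}\to\{1,\dots,N\}$, giving the choice $\sigma_t(Z_0,\dots,Z_t)$ in period $t$; let $\mathbb E_z^\sigma$ be the expectation for the resulting state process started at $Z_0=z$. The value function and the choice-specific continuation values are $$v^*(z)=\sup_\sigma \mathbb E^\sigma_z\sum_{t\ge 0}\beta^t r_{\sigma_t(Z_0,\dots,Z_t)}(Z_t),\qquad \psi_i^*(z)=r_i(z)+\beta\int v^*(z')\,P_i(z,dz').$$ Assume that there are a measurable $g:\mathsf Z\to[0,\infty)$ and constants $m,d\ge 0$ with $\beta m<1$ such that for all $z\in\mathsf Z$ and all $i,j\in\{1,\dots,N\}$ $$\int |r_i(z')|\,P_j(z,dz')\le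 g(z),\qquad \int g(z')\,P_i(z,dz')\le m\,g(z)+d .$$ Let $m',d'>0$ satisfy $Nm'+m>1$, $\beta(Nm'+m)<1$ and $d'\ge d/(Nm'+m-1)$, and put $k(z)=m'\sum_{i=1}^N|r_i(z)|+g(z)+d'$. Let $b_k\mathsf Z$ be the set of measurable $f:\mathsf Z\to\mathbb R$ with $\|f\|_k=\sup_z|f(z)|/k(z)<\infty$, equip $\times_{i=1}^N b_k\mathsf Z$ with the metric $\rho_k(\psi,\tilde\psi)=\max_{i}\|\psi_i-\tilde\psi_i\|_k$, and let $$(Q\psi)_i=r_i+\beta P_i(\psi_1\vee\dots\vee\psi_N),\qquad i=1,\dots,N,$$ where $(P_ih)(z)=\int h(z')\,P_i(z,dz')$. Then the decision problem is well posed: for every plan $\sigma$ and every initial state, the discounted payoff series converges almost surely and its sum is integrable, the supremum defining $v^*(z)$ is finite, $v^*$ is $P_i(z,\cdot)$-integrable for all $i$ and $z$, and $v^*=\psi_1^*\vee\dots\vee\psi_N^*$. Moreover: 1. $Q$ is a well-defined map from $\times_{i=1}^N b_k\mathsf Z$ to itself (the integrals in it are integrals of integrable functions), and it is a contraction of modulus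 $\beta(Nm'+m)$ with respect to $\rho_k$. 2. The unique fixed point of $Q$ in $\times_{i=1}^N b_k\mathsf Z$ is $\psi^*=(\psi_1^*,\dots,\psi_N^*)$. -/

import Mathlib

open MeasureTheory ProbabilityTheory

noncomputable section

namespace SeqDecision

variable {Z : Type*} [MeasurableSpace Z] {N : ℕ}

/-- A plan (nonanticipating policy): in period `t`, after observing the states `z₀, …, z_t`, it
chooses one of the `N` alternatives, measurably in the observed history. -/
structure Plan (Z : Type*) [MeasurableSpace Z] (N : ℕ) where
  act : (t : ℕ) → (Finset.Iic t → Z) → Fin N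
  measurable_act : ∀ t, Measurable (act t)

/-- The law of `Z_{t+1}` given the history `z₀, …, z_t`, when the plan `σ` is followed: it is
`P_i(z_t, ·)`, where `i` is the alternative that the plan selects in period `t`. -/
def stepKernel (P : Fin N → Kernel Z Z) (σ : Plan Z N) (t : ℕ) :
    Kernel (Finset.Iic t → Z) Z where
  toFun h := P (σ.act t h) (h ⟨t, Finset.mem_Iic.2 le_rfl⟩)
  measurable' := by
    have h1 : Measurable (fun p : Fin N × Z => P p.1 p.2) :=
      measurable_from_prod_countable_right fun i => (P i).measurable
    exact h1.comp ((σ.measurable_act t).prodMk (measurable_pi_apply _))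

instance (P : Fin N → Kernel Z Z) [∀ i, IsMarkovKernel (P i)] (σ : Plan Z N) (t : ℕ) :
    IsMarkovKernel (stepKernel P σ t) :=
  ⟨fun h => inferInstanceAs
    (IsProbabilityMeasure (P (σ.act t h) (h ⟨t, Finset.mem_Iic.2 le_rfl⟩)))⟩

/-- The law on the sequence space of the state process `(Z_t)` started at `Z₀ = z` and controlled
by the plan `σ` (Ionescu-Tulcea). -/
def law (P : Fin N → Kernel Z Z) [∀ i, IsMarkovKernel (P i)] (σ : Plan Z N) (z : Z) :
    Measure (ℕ → Z) :=
  Kernel.traj (X := fun _ => Z) (stepKernel P σ) 0 (fun _ => z)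

/-- The discounted period-`t` payoff `β ^ t * r_i(z_t)` along the state path `ω`, where `i` is the
alternative selected by `σ` in period `t`. -/
def payoff (β : ℝ) (r : Fin N → Z → ℝ) (σ : Plan Z N) (t : ℕ) (ω : ℕ → Z) : ℝ :=
  β ^ t * r (σ.act t (fun j => ω j)) (ω t)

/-- The total discounted payoff along the path `ω`. -/
def totalPayoff (β : ℝ) (r : Fin N → Z → ℝ) (σ : Plan Z N) (ω : ℕ → Z) : ℝ :=
  ∑' t, payoff β r σ t ω

/-- The expected total discounted payoff of the plan `σ` from the initial state `z`. -/
def planValue (β : ℝ) (r : Fin N → Z → ℝ) (P : Fin N → Kernel Z Z) [∀ i, IsMarkovKernel (P i)]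
    (σ : Plan Z N) (z : Z) : ℝ :=
  ∫ ω, totalPayoff β r σ ω ∂(law P σ z)

/-- The value function `v*`. -/
def valueFun (β : ℝ) (r : Fin N → Z → ℝ) (P : Fin N → Kernel Z Z) [∀ i, IsMarkovKernel (P i)]
    (z : Z) : ℝ :=
  ⨆ σ : Plan Z N, planValue β r P σ z

/-- The continuation values `ψ*_i`: the expected value of choosing alternative `i` now and
behaving optimally from the next period on. -/
def contValue (β : ℝ) (r : Fin N → Z → ℝ) (P : Fin N → Kernel Z Z) [∀ i, IsMarkovKernel (P i)]
    (i : Fin N) (z : Z) : ℝ :=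
  r i z + β * ∫ z', valueFun β r P z' ∂(P i z)

/-- The pointwise maximum `ψ_1 ∨ … ∨ ψ_N`. -/
def vmax [NeZero N] (ψ : Fin N → Z → ℝ) (z : Z) : ℝ :=
  Finset.univ.sup' Finset.univ_nonempty (fun i => ψ i z)

/-- The operator `Q`, with `(Q ψ)_i = r_i + β P_i (ψ_1 ∨ … ∨ ψ_N)`. -/
def jovanovicOp [NeZero N] (β : ℝ) (r : Fin N → Z → ℝ) (P : Fin N → Kernel Z Z)
    (ψ : Fin N → Z → ℝ) (i : Fin N) (z : Z) : ℝ :=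
  r i z + β * ∫ z', vmax ψ z' ∂(P i z)

/-- The weight function `k = m' ∑ |r_i| + g + d'`. -/
def weight (r : Fin N → Z → ℝ) (g : Z → ℝ) (m' d' : ℝ) (z : Z) : ℝ :=
  m' * ∑ i, |r i z| + g z + d'

/-- The weighted supremum norm `‖f‖_k = sup_z |f z| / k z`. -/
def wnorm (k : Z → ℝ) (f : Z → ℝ) : ℝ := ⨆ z, |f z| / k z

/-- The space `b_k Z` of measurable functions with finite `k`-weighted supremum norm. -/
def wBounded (k : Z → ℝ) : Set (Z → ℝ) :=
  {f | Measurable f ∧ BddAbove (Set.range fun z => |f z| / k z)}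

/-- The `N`-fold product of `b_k Z`. -/
def wBoundedProd (N : ℕ) (k : Z → ℝ) : Set (Fin N → Z → ℝ) := {ψ | ∀ i, ψ i ∈ wBounded k}

/-- The metric `ρ_k(ψ, φ) = max_i ‖ψ_i - φ_i‖_k` on the product. -/
def wdist [NeZero N] (k : Z → ℝ) (ψ φ : Fin N → Z → ℝ) : ℝ :=
  Finset.univ.sup' Finset.univ_nonempty (fun i => wnorm k (ψ i - φ i))

end SeqDecision

end

/-!
The weight `k = m' ∑ |r_i| + g + d'` satisfies `P_i k ≤ c k` with `c = N m' + m`: the first two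
terms of `k` have means at most `N m' g` and `m g + d`, and `d'` is large enough to absorb
`d`. Since `β c < 1`, discounted payoffs of size `O(k)` are absolutely summable in mean, and `Q` is
a `β c`-contraction of the complete space `b_k Z × ⋯ × b_k Z`, so it has a fixed point `ψ`.

Put `v = ψ_1 ∨ ⋯ ∨ ψ_N`. Telescoping `β ^ t v(Z_t)` along the state process of a plan `σ` writes
the gap between `v(z)` and the value of `σ` as the discounted sum of the expected losses
`v(Z_t) - ψ_{σ_t}(Z_t) ≥ 0`. The losses vanish for the stationary plan that always chooses a
maximizer of `ψ`, measurably selected. Hence `v = v*`, so that every fixed point is `ψ*`.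
-/

open scoped ENNReal

namespace SeqDecision

section Vmax

variable {Z : Type*} {N : ℕ} [NeZero N] {ψ φ : Fin N → Z → ℝ} {z : Z} {C : ℝ}

lemma le_vmax (ψ : Fin N → Z → ℝ) (i : Fin N) (z : Z) : ψ i z ≤ vmax ψ z :=
  Finset.le_sup' (fun i => ψ i z) (Finset.mem_univ i)

lemma vmax_le (h : ∀ i, ψ i z ≤ C) : vmax ψ z ≤ C :=
  Finset.sup'_le _ _ fun i _ => h i

lemma exists_eq_vmax (ψ : Fin N → Z → ℝ) (z : Z) : ∃ i, ψ i z = vmax ψ z := by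
  obtain ⟨i, -, hi⟩ := Finset.exists_mem_eq_sup' Finset.univ_nonempty (fun i => ψ i z)
  exact ⟨i, hi.symm⟩

lemma abs_vmax_le (h : ∀ i, |ψ i z| ≤ C) : |vmax ψ z| ≤ C := by
  obtain ⟨i, hi⟩ := exists_eq_vmax ψ z
  exact hi ▸ h i

lemma abs_vmax_sub_vmax_le (h : ∀ i, |ψ i z - φ i z| ≤ C) : |vmax ψ z - vmax φ z| ≤ C := by
  rw [abs_sub_le_iff, sub_le_iff_le_add, sub_le_iff_le_add]
  exact ⟨vmax_le fun i => by linarith [(abs_sub_le_iff.1 (h i)).1, le_vmax φ i z],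
    vmax_le fun i => by linarith [(abs_sub_le_iff.1 (h i)).2, le_vmax ψ i z]⟩

variable [MeasurableSpace Z]

lemma measurable_vmax (hψ : ∀ i, Measurable (ψ i)) : Measurable (vmax ψ) := by
  have hsup : vmax ψ = Finset.univ.sup' Finset.univ_nonempty ψ := by
    ext z
    rw [Finset.sup'_apply, vmax]
  rw [hsup]
  exact Finset.measurable_sup' _ fun i _ => hψ i

lemma exists_measurable_argmax (hψ : ∀ i, Measurable (ψ i)) :
    ∃ s : Z → Fin N, Measurable s ∧ ∀ z, ψ (s z) z = vmax ψ z := by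
  classical
  let s : Z → Fin N := fun z => Fin.find (fun i => ψ i z = vmax ψ z) (exists_eq_vmax ψ z)
  have hmax : ∀ i, MeasurableSet {z | ψ i z = vmax ψ z} := fun i =>
    measurableSet_eq_fun (hψ i) (measurable_vmax hψ)
  have hpreimage : ∀ i, s ⁻¹' {i} =
      {z | ψ i z = vmax ψ z} ∩ ⋂ j, ⋂ _ : j < i, {z | ψ j z = vmax ψ z}ᶜ := fun i => by
    ext z
    simp [s, Fin.find_eq_iff]
  refine ⟨s, measurable_to_countable' fun i => ?_, fun z => Fin.find_spec (exists_eq_vmax ψ z)⟩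
  rw [hpreimage]
  exact (hmax i).inter (.iInter fun j => .iInter fun _ => (hmax j).compl)

end Vmax

section WeightedNorm

variable {Z : Type*} {k : Z → ℝ} {f : Z → ℝ}

lemma wnorm_nonneg (hk : ∀ z, 0 < k z) (f : Z → ℝ) : 0 ≤ wnorm k f :=
  Real.iSup_nonneg fun z => div_nonneg (abs_nonneg _) (hk z).le

lemma wnorm_le (hk : ∀ z, 0 < k z) {C : ℝ} (hC : 0 ≤ C) (h : ∀ z, |f z| ≤ C * k z) :
    wnorm k f ≤ C :=
  Real.iSup_le (fun z => (div_le_iff₀ (hk z)).2 (h z)) hC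

section

variable {N : ℕ} [NeZero N] {ψ φ : Fin N → Z → ℝ}

lemma wnorm_sub_le_wdist (k : Z → ℝ) (ψ φ : Fin N → Z → ℝ) (i : Fin N) :
    wnorm k (ψ i - φ i) ≤ wdist k ψ φ :=
  Finset.le_sup' (fun i => wnorm k (ψ i - φ i)) (Finset.mem_univ i)

lemma wdist_nonneg (hk : ∀ z, 0 < k z) (ψ φ : Fin N → Z → ℝ) : 0 ≤ wdist k ψ φ :=
  (wnorm_nonneg hk _).trans (wnorm_sub_le_wdist k ψ φ 0)

lemma wdist_le (hk : ∀ z, 0 < k z) {C : ℝ} (hC : 0 ≤ C)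
    (h : ∀ i z, |ψ i z - φ i z| ≤ C * k z) : wdist k ψ φ ≤ C :=
  Finset.sup'_le _ _ fun i _ => wnorm_le hk hC (h i)

end

variable [MeasurableSpace Z]

lemma mem_wBounded_iff (hk : ∀ z, 0 < k z) :
    f ∈ wBounded k ↔ Measurable f ∧ ∃ C, ∀ z, |f z| ≤ C * k z := by
  refine and_congr_right fun _ => exists_congr fun C => ?_
  simp only [mem_upperBounds, Set.forall_mem_range, div_le_iff₀ (hk _)]

lemma abs_le_wnorm_mul (hk : ∀ z, 0 < k z) (hf : f ∈ wBounded k) (z : Z) :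
    |f z| ≤ wnorm k f * k z :=
  (div_le_iff₀ (hk z)).1 (le_ciSup hf.2 z)

/-- The space `b_k Z` of functions with finite weighted supremum norm, as a linear subspace of the
space of all functions. -/
def wBoundedSubmodule (hk : ∀ z, 0 < k z) : Submodule ℝ (Z → ℝ) where
  carrier := wBounded k
  zero_mem' := (mem_wBounded_iff hk).2 ⟨measurable_const, 0, by simp⟩
  add_mem' {f h} hf hh := by
    refine (mem_wBounded_iff hk).2 ⟨hf.1.add hh.1, wnorm k f + wnorm k h, fun z => ?_⟩
    rw [add_mul]
    exact (abs_add_le _ _).trans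
      (add_le_add (abs_le_wnorm_mul hk hf z) (abs_le_wnorm_mul hk hh z))
  smul_mem' a f hf := by
    refine (mem_wBounded_iff hk).2 ⟨hf.1.const_smul a, |a| * wnorm k f, fun z => ?_⟩
    rw [Pi.smul_apply, smul_eq_mul, abs_mul, mul_assoc]
    exact mul_le_mul_of_nonneg_left (abs_le_wnorm_mul hk hf z) (abs_nonneg a)

variable {N : ℕ} {ψ φ : Fin N → Z → ℝ}

lemma exists_forall_abs_le_mul (hk : ∀ z, 0 < k z) (hψ : ψ ∈ wBoundedProd N k) :
    ∃ C, 0 ≤ C ∧ ∀ i z, |ψ i z| ≤ C * k z := by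
  refine ⟨∑ i, wnorm k (ψ i), Finset.sum_nonneg fun i _ => wnorm_nonneg hk _, fun i z => ?_⟩
  refine (abs_le_wnorm_mul hk (hψ i) z).trans (mul_le_mul_of_nonneg_right ?_ (hk z).le)
  exact Finset.single_le_sum (f := fun i => wnorm k (ψ i)) (fun i _ => wnorm_nonneg hk _)
    (Finset.mem_univ i)

variable [NeZero N]

lemma vmax_mem_wBounded (hk : ∀ z, 0 < k z) (hψ : ψ ∈ wBoundedProd N k) :
    vmax ψ ∈ wBounded k := by
  obtain ⟨C, -, hC⟩ := exists_forall_abs_le_mul hk hψ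
  exact (mem_wBounded_iff hk).2
    ⟨measurable_vmax fun i => (hψ i).1, C, fun z => abs_vmax_le fun i => hC i z⟩

lemma abs_sub_le_wdist_mul (hk : ∀ z, 0 < k z) (hψ : ψ ∈ wBoundedProd N k)
    (hφ : φ ∈ wBoundedProd N k) (i : Fin N) (z : Z) :
    |ψ i z - φ i z| ≤ wdist k ψ φ * k z :=
  (abs_le_wnorm_mul hk ((wBoundedSubmodule hk).sub_mem (hψ i) (hφ i)) z).trans
    (mul_le_mul_of_nonneg_right (wnorm_sub_le_wdist k ψ φ i) (hk z).le)

lemma wnorm_vmax_sub_vmax_le (hk : ∀ z, 0 < k z) (hψ : ψ ∈ wBoundedProd N k)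
    (hφ : φ ∈ wBoundedProd N k) : wnorm k (vmax ψ - vmax φ) ≤ wdist k ψ φ :=
  wnorm_le hk (wdist_nonneg hk ψ φ) fun z =>
    abs_vmax_sub_vmax_le fun i => abs_sub_le_wdist_mul hk hψ hφ i z

end WeightedNorm

section Completeness

variable {Z : Type*} [MeasurableSpace Z] {N : ℕ} {k : Z → ℝ}

/-- The `N`-tuples of bounded measurable functions, with the metric of uniform convergence. Division
by the weight identifies `wBoundedProd N k` with this space, whose completeness is available from
that of `ℓ^∞`. -/
def boundedMeasurable (Z : Type*) [MeasurableSpace Z] (N : ℕ) :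
    Set (Fin N → lp (fun _ : Z => ℝ) ∞) :=
  {u | ∀ i, Measurable (u i)}

lemma isClosed_boundedMeasurable : IsClosed (boundedMeasurable Z N) := by
  refine IsSeqClosed.isClosed fun u u₀ hu hlim i => ?_
  refine measurable_of_tendsto_metrizable (fun n => hu n i) ?_
  exact (lp.uniformContinuous_coe.continuous.tendsto (u₀ i)).comp (tendsto_pi_nhds.1 hlim i)

/-- Multiplication of a tuple of bounded functions by the weight. -/
def mulWeight (k : Z → ℝ) (u : Fin N → lp (fun _ : Z => ℝ) ∞) (i : Fin N) (z : Z) : ℝ :=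
  u i z * k z

lemma mulWeight_mem_wBoundedProd (hk : ∀ z, 0 < k z) (hkm : Measurable k)
    {u : Fin N → lp (fun _ : Z => ℝ) ∞} (hu : u ∈ boundedMeasurable Z N) :
    mulWeight k u ∈ wBoundedProd N k := fun i => by
  refine (mem_wBounded_iff hk).2 ⟨(hu i).mul hkm, ‖u i‖, fun z => ?_⟩
  rw [mulWeight, abs_mul, abs_of_pos (hk z)]
  exact mul_le_mul_of_nonneg_right (lp.norm_apply_le_norm ENNReal.top_ne_zero (u i) z) (hk z).le

lemma exists_mulWeight_eq (hk : ∀ z, 0 < k z) (hkm : Measurable k) {ψ : Fin N → Z → ℝ}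
    (hψ : ψ ∈ wBoundedProd N k) : ∃ u ∈ boundedMeasurable Z N, mulWeight k u = ψ := by
  have hmem : ∀ i, Memℓp (fun z => ψ i z / k z) ∞ := fun i => by
    refine memℓp_infty ?_
    simpa only [norm_div, Real.norm_eq_abs, abs_of_pos (hk _)] using (hψ i).2
  refine ⟨fun i => ⟨_, hmem i⟩, fun i => (hψ i).1.div hkm, ?_⟩
  ext i z
  exact div_mul_cancel₀ _ (hk z).ne'

variable [NeZero N]

lemma wdist_mulWeight (hk : ∀ z, 0 < k z) (hkm : Measurable k)
    {u w : Fin N → lp (fun _ : Z => ℝ) ∞} (hu : u ∈ boundedMeasurable Z N)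
    (hw : w ∈ boundedMeasurable Z N) : wdist k (mulWeight k u) (mulWeight k w) = dist u w := by
  have habs : ∀ i z, |mulWeight k u i z - mulWeight k w i z| = ‖(u i - w i) z‖ * k z :=
    fun i z => by
      rw [mulWeight, mulWeight, ← sub_mul, abs_mul, abs_of_pos (hk z)]
      rfl
  apply le_antisymm
  · refine wdist_le hk dist_nonneg fun i z => ?_
    rw [habs]
    refine mul_le_mul_of_nonneg_right ?_ (hk z).le
    refine (lp.norm_apply_le_norm ENNReal.top_ne_zero (u i - w i) z).trans ?_
    exact (dist_eq_norm (u i) (w i)).symm.trans_le (dist_le_pi_dist u w i)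
  · have hdist := wdist_nonneg hk (mulWeight k u) (mulWeight k w)
    refine (dist_pi_le_iff hdist).2 fun i => ?_
    rw [dist_eq_norm]
    refine lp.norm_le_of_forall_le hdist fun z => le_of_mul_le_mul_right ?_ (hk z)
    rw [← habs]
    exact abs_sub_le_wdist_mul hk (mulWeight_mem_wBoundedProd hk hkm hu)
      (mulWeight_mem_wBoundedProd hk hkm hw) i z

lemma exists_fixedPoint_of_wdist_le (hk : ∀ z, 0 < k z) (hkm : Measurable k)
    {Q : (Fin N → Z → ℝ) → Fin N → Z → ℝ} {q : ℝ} (hq0 : 0 ≤ q) (hq1 : q < 1)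
    (hQ : Set.MapsTo Q (wBoundedProd N k) (wBoundedProd N k))
    (hlip : ∀ ψ ∈ wBoundedProd N k, ∀ φ ∈ wBoundedProd N k,
      wdist k (Q ψ) (Q φ) ≤ q * wdist k ψ φ) :
    ∃ ψ ∈ wBoundedProd N k, Q ψ = ψ := by
  have hmem : ∀ u : boundedMeasurable Z N, mulWeight k u ∈ wBoundedProd N k := fun u =>
    mulWeight_mem_wBoundedProd hk hkm u.2
  choose T hT hQT using fun u : boundedMeasurable Z N => exists_mulWeight_eq hk hkm (hQ (hmem u))
  let T' : boundedMeasurable Z N → boundedMeasurable Z N := fun u => ⟨T u, hT u⟩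
  have hT' : ContractingWith ⟨q, hq0⟩ T' := by
    refine ⟨hq1, LipschitzWith.of_dist_le_mul fun u w => ?_⟩
    rw [Subtype.dist_eq, Subtype.dist_eq, ← wdist_mulWeight hk hkm (hT u) (hT w), hQT, hQT,
      ← wdist_mulWeight hk hkm u.2 w.2]
    exact hlip _ (hmem u) _ (hmem w)
  have : CompleteSpace (boundedMeasurable Z N) :=
    isClosed_boundedMeasurable.completeSpace_coe
  have : Nonempty (boundedMeasurable Z N) := ⟨0, fun _ => measurable_const⟩
  let u := hT'.fixedPoint
  have hu : T u = u := congrArg Subtype.val hT'.fixedPoint_isFixedPt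
  exact ⟨mulWeight k u, hmem u, by rw [← hQT, hu]⟩

end Completeness

section DriftWeight

variable {Z : Type*} [MeasurableSpace Z] {ι : Type*}

/-- A positive weight function `k` that each of the kernels increases in the mean by the factor `c`
at most: a geometric drift (Lyapunov) condition. -/
structure IsDriftWeight (P : ι → Kernel Z Z) (k : Z → ℝ) (c : ℝ) : Prop where
  measurable : Measurable k
  pos : ∀ z, 0 < k z
  integrable : ∀ i z, Integrable k (P i z)
  integral_le : ∀ i z, ∫ z', k z' ∂(P i z) ≤ c * k z
  factor_nonneg : 0 ≤ c

namespace IsDriftWeight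

variable {P : ι → Kernel Z Z} {k f : Z → ℝ} {c : ℝ}

lemma integrable_of_mem_wBounded (hk : IsDriftWeight P k c) (hf : f ∈ wBounded k) (i : ι) (z : Z) :
    Integrable f (P i z) :=
  ((hk.integrable i z).const_mul (wnorm k f)).mono' hf.1.aestronglyMeasurable
    (ae_of_all _ (abs_le_wnorm_mul hk.pos hf))

lemma abs_integral_le (hk : IsDriftWeight P k c) (hf : f ∈ wBounded k) (i : ι) (z : Z) :
    |∫ z', f z' ∂(P i z)| ≤ c * wnorm k f * k z :=
  calc |∫ z', f z' ∂(P i z)| ≤ ∫ z', wnorm k f * k z' ∂(P i z) :=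
        norm_integral_le_of_norm_le (f := f) ((hk.integrable i z).const_mul _)
          (ae_of_all _ (abs_le_wnorm_mul hk.pos hf))
    _ = wnorm k f * ∫ z', k z' ∂(P i z) := integral_const_mul _ _
    _ ≤ wnorm k f * (c * k z) :=
        mul_le_mul_of_nonneg_left (hk.integral_le i z) (wnorm_nonneg hk.pos f)
    _ = c * wnorm k f * k z := by ring

lemma integral_mem_wBounded (hk : IsDriftWeight P k c) (hf : f ∈ wBounded k) (i : ι) :
    (fun z => ∫ z', f z' ∂(P i z)) ∈ wBounded k :=
  (mem_wBounded_iff hk.pos).2 ⟨(hf.1.stronglyMeasurable.integral_kernel (κ := P i)).measurable,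
    c * wnorm k f, hk.abs_integral_le hf i⟩

end IsDriftWeight

end DriftWeight

section Operator

variable {Z : Type*} [MeasurableSpace Z] {N : ℕ} {β : ℝ} {r : Fin N → Z → ℝ}
  {P : Fin N → Kernel Z Z} {k : Z → ℝ} {c : ℝ}

/-- A weight function for the decision problem: the payoffs are bounded by a multiple of `k`, and
discounting outweighs the growth of `k` along the state process. -/
structure IsDecisionWeight (β : ℝ) (r : Fin N → Z → ℝ) (P : Fin N → Kernel Z Z) (k : Z → ℝ)
    (c : ℝ) : Prop extends IsDriftWeight P k c where
  discount_nonneg : 0 ≤ β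
  discount_mul_factor_lt_one : β * c < 1
  payoff_mem : r ∈ wBoundedProd N k

variable [NeZero N] {ψ φ : Fin N → Z → ℝ}

lemma IsDriftWeight.integrable_vmax (hk : IsDriftWeight P k c) (hψ : ψ ∈ wBoundedProd N k)
    (i : Fin N) (z : Z) : Integrable (vmax ψ) (P i z) :=
  hk.integrable_of_mem_wBounded (vmax_mem_wBounded hk.pos hψ) i z

lemma IsDriftWeight.jovanovicOp_mem (hk : IsDriftWeight P k c) (hr : r ∈ wBoundedProd N k)
    (hψ : ψ ∈ wBoundedProd N k) : jovanovicOp β r P ψ ∈ wBoundedProd N k := fun i =>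
  let V := wBoundedSubmodule hk.pos
  V.add_mem (hr i)
    (V.smul_mem β (hk.integral_mem_wBounded (vmax_mem_wBounded hk.pos hψ) i))

lemma IsDriftWeight.wdist_jovanovicOp_le (hk : IsDriftWeight P k c) (hβ : 0 ≤ β)
    (hψ : ψ ∈ wBoundedProd N k) (hφ : φ ∈ wBoundedProd N k) :
    wdist k (jovanovicOp β r P ψ) (jovanovicOp β r P φ) ≤ β * c * wdist k ψ φ := by
  have hdist := wdist_nonneg hk.pos ψ φ
  refine wdist_le hk.pos (mul_nonneg (mul_nonneg hβ hk.factor_nonneg) hdist) fun i z => ?_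
  have hdiff : jovanovicOp β r P ψ i z - jovanovicOp β r P φ i z =
      β * ∫ z', (vmax ψ - vmax φ) z' ∂(P i z) := by
    simp only [Pi.sub_apply]
    rw [integral_sub (hk.integrable_vmax hψ i z) (hk.integrable_vmax hφ i z), jovanovicOp,
      jovanovicOp]
    ring
  have hmem : vmax ψ - vmax φ ∈ wBounded k := (wBoundedSubmodule hk.pos).sub_mem
    (vmax_mem_wBounded hk.pos hψ) (vmax_mem_wBounded hk.pos hφ)
  calc |jovanovicOp β r P ψ i z - jovanovicOp β r P φ i z|
      = β * |∫ z', (vmax ψ - vmax φ) z' ∂(P i z)| := by rw [hdiff, abs_mul, abs_of_nonneg hβ]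
    _ ≤ β * (c * wnorm k (vmax ψ - vmax φ) * k z) :=
        mul_le_mul_of_nonneg_left (hk.abs_integral_le hmem i z) hβ
    _ ≤ β * (c * wdist k ψ φ * k z) := by
        have := hk.factor_nonneg
        have := (hk.pos z).le
        gcongr
        exact wnorm_vmax_sub_vmax_le hk.pos hψ hφ
    _ = β * c * wdist k ψ φ * k z := by ring

lemma IsDecisionWeight.exists_fixedPoint (hk : IsDecisionWeight β r P k c) :
    ∃ ψ ∈ wBoundedProd N k, jovanovicOp β r P ψ = ψ :=
  exists_fixedPoint_of_wdist_le hk.pos hk.measurable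
    (mul_nonneg hk.discount_nonneg hk.factor_nonneg) hk.discount_mul_factor_lt_one
    (fun _ hψ => hk.jovanovicOp_mem hk.payoff_mem hψ)
    (fun _ hψ _ hφ => hk.wdist_jovanovicOp_le hk.discount_nonneg hψ hφ)

end Operator

section SummableIntegrals

variable {Ω ι E : Type*} [MeasurableSpace Ω] {μ : Measure Ω} [Countable ι] [NormedAddCommGroup E]
  [CompleteSpace E] {F : ι → Ω → E}

lemma ae_summable_and_integrable_tsum (hF : ∀ n, Integrable (F n) μ)
    (hsum : Summable fun n => ∫ ω, ‖F n ω‖ ∂μ) :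
    (∀ᵐ ω ∂μ, Summable fun n => F n ω) ∧ Integrable (fun ω => ∑' n, F n ω) μ := by
  let G : ι → Lp E 1 μ := fun n => (hF n).toL1 (F n)
  have hG : ∑' n, ‖G n‖ₑ ≠ ∞ := by
    simp_rw [G, Integrable.enorm_toL1, ← ofReal_integral_norm_eq_lintegral_enorm (hF _)]
    exact hsum.tsum_ofReal_ne_top
  have hhasSum : ∀ᵐ ω ∂μ, HasSum (fun n => F n ω) ((∑' n, G n : Lp E 1 μ) ω) := by
    filter_upwards [Lp.hasSum_coeFn_tsum hG, ae_all_iff.2 fun n => (hF n).coeFn_toL1] with ω h hn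
    simpa only [G, hn] using h
  exact ⟨hhasSum.mono fun ω h => h.summable,
    (L1.integrable_coeFn _).congr (hhasSum.mono fun ω h => h.tsum_eq.symm)⟩

end SummableIntegrals

section Law

variable {Z : Type*} [MeasurableSpace Z] {N : ℕ}

/-- The alternative that the plan selects in period `t` along the state path `ω`. -/
def Plan.choice (σ : Plan Z N) (t : ℕ) (ω : ℕ → Z) : Fin N :=
  σ.act t (Preorder.frestrictLe t ω)

lemma Plan.measurable_apply_choice (σ : Plan Z N) (t : ℕ) {ψ : Fin N → Z → ℝ}
    (hψ : ∀ i, Measurable (ψ i)) : Measurable fun ω => ψ (σ.choice t ω) (ω t) := by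
  have hchoice : Measurable (σ.choice t) :=
    (σ.measurable_act t).comp (Preorder.measurable_frestrictLe t)
  have huncurry : Measurable fun p : Fin N × Z => ψ p.1 p.2 :=
    measurable_from_prod_countable_right hψ
  exact huncurry.comp (hchoice.prodMk (measurable_pi_apply t))

variable (P : Fin N → Kernel Z Z) [∀ i, IsMarkovKernel (P i)] (σ : Plan Z N) (z : Z)

instance : IsProbabilityMeasure (law P σ z) :=
  inferInstanceAs (IsProbabilityMeasure (Kernel.traj (X := fun _ => Z) (stepKernel P σ) 0 _))

lemma law_map_zero : (law P σ z).map (fun ω => ω 0) = Measure.dirac z := by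
  have hinit : (law P σ z).map (Preorder.frestrictLe 0) = Measure.dirac fun _ => z := by
    rw [law, Kernel.traj_map_frestrictLe_apply, Kernel.partialTraj_self, Kernel.id_apply]
  have hcoord := congrArg (Measure.map fun x : Finset.Iic 0 → Z => x ⟨0, by simp⟩) hinit
  rwa [Measure.map_map (by fun_prop) (by fun_prop), Measure.map_dirac' (by fun_prop)] at hcoord

lemma law_map_succ (t : ℕ) : (law P σ z).map (fun ω => ω (t + 1)) =
    stepKernel P σ t ∘ₘ (law P σ z).map (Preorder.frestrictLe t) := by
  rw [law, Kernel.traj_map_frestrictLe_apply, ← Measure.snd_compProd,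
    Kernel.partialTraj_compProd_eq_map_traj (zero_le (a := t)), Measure.snd,
    Measure.map_map measurable_snd (by fun_prop)]
  rfl

variable {P σ z} {f : Z → ℝ}

lemma integrable_coord_zero (hf : Measurable f) : Integrable (fun ω => f (ω 0)) (law P σ z) := by
  have hdirac : Integrable f ((law P σ z).map fun ω => ω 0) := by
    rw [law_map_zero]
    exact integrable_dirac' hf.stronglyMeasurable enorm_lt_top
  exact hdirac.comp_measurable (measurable_pi_apply 0)

lemma integral_coord_zero (hf : Measurable f) : ∫ ω, f (ω 0) ∂(law P σ z) = f z := by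
  rw [← integral_map (φ := fun ω : ℕ → Z => ω 0) (measurable_pi_apply 0).aemeasurable
    hf.aestronglyMeasurable, law_map_zero, integral_dirac' _ _ hf.stronglyMeasurable]

lemma integrable_coord_succ (hf : Measurable f) (t : ℕ) (hfP : ∀ i z, Integrable f (P i z))
    (hnorm : Integrable (fun ω => ∫ z', ‖f z'‖ ∂(P (σ.choice t ω) (ω t))) (law P σ z)) :
    Integrable (fun ω => f (ω (t + 1))) (law P σ z) := by
  have hstep : Integrable f ((law P σ z).map fun ω => ω (t + 1)) := by
    rw [law_map_succ, Measure.integrable_comp_iff hf.aestronglyMeasurable]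
    refine ⟨ae_of_all _ fun h => hfP _ _, ?_⟩
    rw [integrable_map_measure hf.norm.stronglyMeasurable.integral_kernel.aestronglyMeasurable
      (by fun_prop)]
    exact hnorm
  exact hstep.comp_measurable (measurable_pi_apply (t + 1))

lemma integral_coord_succ (hf : Measurable f) (t : ℕ)
    (hint : Integrable (fun ω => f (ω (t + 1))) (law P σ z)) :
    ∫ ω, f (ω (t + 1)) ∂(law P σ z) =
      ∫ ω, ∫ z', f z' ∂(P (σ.choice t ω) (ω t)) ∂(law P σ z) := by
  have hcoord := (measurable_pi_apply (X := fun _ => Z) (t + 1)).aemeasurable (μ := law P σ z)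
  have hstep := (integrable_map_measure hf.aestronglyMeasurable hcoord).2 hint
  rw [← integral_map hcoord hf.aestronglyMeasurable]
  rw [law_map_succ, Measure.comp_eq_comp_const_apply] at hstep ⊢
  rw [Kernel.integral_comp hstep, Kernel.const_apply,
    integral_map (by fun_prop) hf.stronglyMeasurable.integral_kernel.aestronglyMeasurable]
  rfl

end Law

namespace IsDriftWeight

variable {Z : Type*} [MeasurableSpace Z] {N : ℕ} {P : Fin N → Kernel Z Z}
  [∀ i, IsMarkovKernel (P i)] {k : Z → ℝ} {c : ℝ}

lemma integrable_coord_and_integral_le (hk : IsDriftWeight P k c) (σ : Plan Z N) (z : Z)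
    (t : ℕ) : Integrable (fun ω => k (ω t)) (law P σ z) ∧
      ∫ ω, k (ω t) ∂(law P σ z) ≤ c ^ t * k z := by
  induction t with
  | zero => exact ⟨integrable_coord_zero hk.measurable, by simp [integral_coord_zero hk.measurable]⟩
  | succ t ih =>
    obtain ⟨hint, hle⟩ := ih
    have hnorm : ∀ i z, ∫ z', ‖k z'‖ ∂(P i z) = ∫ z', k z' ∂(P i z) := fun i z =>
      integral_congr_ae (ae_of_all _ fun z' => Real.norm_of_nonneg (hk.pos z').le)
    have hcond : Integrable (fun ω => ∫ z', k z' ∂(P (σ.choice t ω) (ω t))) (law P σ z) := by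
      have hmeas := σ.measurable_apply_choice t fun i =>
        (hk.measurable.stronglyMeasurable.integral_kernel (κ := P i)).measurable
      refine (hint.const_mul c).mono' hmeas.aestronglyMeasurable (ae_of_all _ fun ω => ?_)
      exact (norm_integral_le_integral_norm _).trans
        ((hnorm _ _).trans_le (hk.integral_le _ _))
    have hsucc : Integrable (fun ω => k (ω (t + 1))) (law P σ z) :=
      integrable_coord_succ hk.measurable t hk.integrable (by simpa only [hnorm] using hcond)
    refine ⟨hsucc, ?_⟩
    calc ∫ ω, k (ω (t + 1)) ∂(law P σ z)
        = ∫ ω, ∫ z', k z' ∂(P (σ.choice t ω) (ω t)) ∂(law P σ z) :=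
          integral_coord_succ hk.measurable t hsucc
      _ ≤ ∫ ω, c * k (ω t) ∂(law P σ z) :=
          integral_mono hcond (hint.const_mul c) fun ω => hk.integral_le _ _
      _ = c * ∫ ω, k (ω t) ∂(law P σ z) := integral_const_mul _ _
      _ ≤ c * (c ^ t * k z) := mul_le_mul_of_nonneg_left hle hk.factor_nonneg
      _ = c ^ (t + 1) * k z := by ring

variable {ψ : Fin N → Z → ℝ}

lemma integrable_apply_choice (hk : IsDriftWeight P k c) (hψ : ψ ∈ wBoundedProd N k)
    (σ : Plan Z N) (z : Z) (t : ℕ) :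
    Integrable (fun ω => ψ (σ.choice t ω) (ω t)) (law P σ z) := by
  obtain ⟨C, -, hC⟩ := exists_forall_abs_le_mul hk.pos hψ
  exact ((hk.integrable_coord_and_integral_le σ z t).1.const_mul C).mono'
    (σ.measurable_apply_choice t fun i => (hψ i).1).aestronglyMeasurable
    (ae_of_all _ fun ω => hC _ _)

lemma exists_integral_norm_apply_choice_le (hk : IsDriftWeight P k c) (hψ : ψ ∈ wBoundedProd N k)
    (σ : Plan Z N) (z : Z) :
    ∃ C, ∀ t, ∫ ω, ‖ψ (σ.choice t ω) (ω t)‖ ∂(law P σ z) ≤ C * c ^ t := by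
  obtain ⟨C, hC0, hC⟩ := exists_forall_abs_le_mul hk.pos hψ
  refine ⟨C * k z, fun t => ?_⟩
  obtain ⟨hint, hle⟩ := hk.integrable_coord_and_integral_le σ z t
  calc ∫ ω, ‖ψ (σ.choice t ω) (ω t)‖ ∂(law P σ z) ≤ ∫ ω, C * k (ω t) ∂(law P σ z) :=
        integral_mono (hk.integrable_apply_choice hψ σ z t).norm (hint.const_mul C)
          fun ω => hC _ _
    _ = C * ∫ ω, k (ω t) ∂(law P σ z) := integral_const_mul _ _
    _ ≤ C * (c ^ t * k z) := mul_le_mul_of_nonneg_left hle hC0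
    _ = C * k z * c ^ t := by ring

lemma summable_discounted_integral_norm (hk : IsDriftWeight P k c) {β : ℝ} (hβ : 0 ≤ β)
    (hβc : β * c < 1) (hψ : ψ ∈ wBoundedProd N k) (σ : Plan Z N) (z : Z) :
    Summable fun t => ∫ ω, ‖β ^ t * ψ (σ.choice t ω) (ω t)‖ ∂(law P σ z) := by
  obtain ⟨C, hC⟩ := hk.exists_integral_norm_apply_choice_le hψ σ z
  have hgeom : Summable fun t : ℕ => C * (β * c) ^ t :=
    (summable_geometric_of_lt_one (mul_nonneg hβ hk.factor_nonneg) hβc).mul_left C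
  refine hgeom.of_nonneg_of_le (fun t => integral_nonneg fun ω => norm_nonneg _) fun t => ?_
  simp only [norm_mul, norm_pow, Real.norm_of_nonneg hβ]
  rw [integral_const_mul, mul_pow, mul_left_comm]
  exact mul_le_mul_of_nonneg_left (hC t) (pow_nonneg hβ t)

end IsDriftWeight

section Verification

variable {Z : Type*} [MeasurableSpace Z] {N : ℕ} {β : ℝ} {r : Fin N → Z → ℝ}
  {P : Fin N → Kernel Z Z} {k v : Z → ℝ} {c : ℝ}

/-- What is lost against the continuation value `v` by choosing alternative `i` in the state `z`
and receiving `v` from the next period on. -/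
noncomputable def bellmanLoss (β : ℝ) (r : Fin N → Z → ℝ) (P : Fin N → Kernel Z Z) (v : Z → ℝ)
    (i : Fin N) (z : Z) : ℝ :=
  v z - (r i z + β * ∫ z', v z' ∂(P i z))

/-- The plan that chooses the alternative `s z` whenever the current state is `z`. -/
def Plan.stationary (s : Z → Fin N) (hs : Measurable s) : Plan Z N where
  act t h := s (h ⟨t, Finset.mem_Iic.2 le_rfl⟩)
  measurable_act _ := hs.comp (measurable_pi_apply _)

namespace IsDecisionWeight

variable [∀ i, IsMarkovKernel (P i)]

lemma integrable_payoff (hk : IsDecisionWeight β r P k c) (σ : Plan Z N) (z : Z) (t : ℕ) :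
    Integrable (payoff β r σ t) (law P σ z) :=
  (hk.integrable_apply_choice hk.payoff_mem σ z t).const_mul (β ^ t)

lemma summable_integral_norm_payoff (hk : IsDecisionWeight β r P k c) (σ : Plan Z N) (z : Z) :
    Summable fun t => ∫ ω, ‖payoff β r σ t ω‖ ∂(law P σ z) :=
  hk.summable_discounted_integral_norm hk.discount_nonneg hk.discount_mul_factor_lt_one
    hk.payoff_mem σ z

lemma ae_summable_payoff_and_integrable_totalPayoff (hk : IsDecisionWeight β r P k c)
    (σ : Plan Z N) (z : Z) :
    (∀ᵐ ω ∂(law P σ z), Summable fun t => payoff β r σ t ω) ∧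
      Integrable (totalPayoff β r σ) (law P σ z) :=
  ae_summable_and_integrable_tsum (hk.integrable_payoff σ z)
    (hk.summable_integral_norm_payoff σ z)

lemma hasSum_planValue (hk : IsDecisionWeight β r P k c) (σ : Plan Z N) (z : Z) :
    HasSum (fun t => ∫ ω, payoff β r σ t ω ∂(law P σ z)) (planValue β r P σ z) :=
  hasSum_integral_of_summable_integral_norm (hk.integrable_payoff σ z)
    (hk.summable_integral_norm_payoff σ z)

lemma hasSum_discounted_integral_sub (hk : IsDecisionWeight β r P k c) (hv : v ∈ wBounded k)
    (σ : Plan Z N) (z : Z) :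
    HasSum (fun t => β ^ t * ∫ ω, v (ω t) ∂(law P σ z) -
      β ^ (t + 1) * ∫ ω, v (ω (t + 1)) ∂(law P σ z)) (v z) := by
  have hsummable : Summable fun t => ∫ ω, β ^ t * v (ω t) ∂(law P σ z) :=
    (hk.summable_discounted_integral_norm hk.discount_nonneg hk.discount_mul_factor_lt_one
      (ψ := fun _ => v) (fun _ => hv) σ z).of_norm_bounded
      fun t => norm_integral_le_integral_norm _
  simp only [integral_const_mul] at hsummable
  have htail := (hasSum_nat_add_iff' 1).2 hsummable.hasSum
  simpa [integral_coord_zero hv.1] using hsummable.hasSum.sub htail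

lemma discounted_integral_bellmanLoss (hk : IsDecisionWeight β r P k c) (hv : v ∈ wBounded k)
    (σ : Plan Z N) (z : Z) (t : ℕ) :
    β ^ t * ∫ ω, bellmanLoss β r P v (σ.choice t ω) (ω t) ∂(law P σ z) =
      β ^ t * ∫ ω, v (ω t) ∂(law P σ z) - β ^ (t + 1) * ∫ ω, v (ω (t + 1)) ∂(law P σ z) -
        ∫ ω, payoff β r σ t ω ∂(law P σ z) := by
  have hcoord : ∀ t, Integrable (fun ω => v (ω t)) (law P σ z) :=
    hk.integrable_apply_choice (ψ := fun _ => v) (fun _ => hv) σ z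
  have hcond : Integrable (fun ω => ∫ z', v z' ∂(P (σ.choice t ω) (ω t))) (law P σ z) :=
    hk.integrable_apply_choice (hk.integral_mem_wBounded hv) σ z t
  have hreward : Integrable (fun ω => r (σ.choice t ω) (ω t)) (law P σ z) :=
    hk.integrable_apply_choice hk.payoff_mem σ z t
  have hpayoff : ∫ ω, payoff β r σ t ω ∂(law P σ z) =
      β ^ t * ∫ ω, r (σ.choice t ω) (ω t) ∂(law P σ z) := integral_const_mul _ _
  have hchosen : Integrable (fun ω => r (σ.choice t ω) (ω t) +
      β * ∫ z', v z' ∂(P (σ.choice t ω) (ω t))) (law P σ z) := hreward.add (hcond.const_mul β)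
  simp only [bellmanLoss]
  rw [integral_sub (hcoord t) hchosen, integral_add hreward (hcond.const_mul β),
    integral_const_mul, hpayoff, integral_coord_succ hv.1 t (hcoord (t + 1))]
  ring

lemma hasSum_discounted_integral_bellmanLoss (hk : IsDecisionWeight β r P k c)
    (hv : v ∈ wBounded k) (σ : Plan Z N) (z : Z) :
    HasSum (fun t => β ^ t * ∫ ω, bellmanLoss β r P v (σ.choice t ω) (ω t) ∂(law P σ z))
      (v z - planValue β r P σ z) :=
  ((hk.hasSum_discounted_integral_sub hv σ z).sub (hk.hasSum_planValue σ z)).congr_fun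
    (hk.discounted_integral_bellmanLoss hv σ z)

lemma planValue_le (hk : IsDecisionWeight β r P k c) (hv : v ∈ wBounded k)
    (hloss : ∀ i z, 0 ≤ bellmanLoss β r P v i z) (σ : Plan Z N) (z : Z) :
    planValue β r P σ z ≤ v z :=
  sub_nonneg.1 <| (hk.hasSum_discounted_integral_bellmanLoss hv σ z).nonneg fun t =>
    mul_nonneg (pow_nonneg hk.discount_nonneg t) (integral_nonneg fun _ => hloss _ _)

lemma planValue_stationary (hk : IsDecisionWeight β r P k c) (hv : v ∈ wBounded k)
    {s : Z → Fin N} (hs : Measurable s) (hloss : ∀ z, bellmanLoss β r P v (s z) z = 0) (z : Z) :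
    planValue β r P (Plan.stationary s hs) z = v z := by
  have hzero : ∀ t ω,
      bellmanLoss β r P v ((Plan.stationary s hs).choice t ω) (ω t) = 0 := fun t ω => hloss (ω t)
  have hsum := hk.hasSum_discounted_integral_bellmanLoss hv (Plan.stationary s hs) z
  simp only [hzero, integral_zero, mul_zero] at hsum
  exact (sub_eq_zero.1 (hsum.unique hasSum_zero)).symm

variable [NeZero N] {ψ : Fin N → Z → ℝ}

lemma isGreatest_planValue (hk : IsDecisionWeight β r P k c) (hψ : ψ ∈ wBoundedProd N k)
    (hfix : jovanovicOp β r P ψ = ψ) (z : Z) :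
    IsGreatest (Set.range fun σ : Plan Z N => planValue β r P σ z) (vmax ψ z) := by
  have hv := vmax_mem_wBounded hk.pos hψ
  have hloss : ∀ i z, bellmanLoss β r P (vmax ψ) i z = vmax ψ z - ψ i z := fun i z =>
    congrArg (vmax ψ z - ·) (congrFun (congrFun hfix i) z)
  obtain ⟨s, hs, hs_max⟩ := exists_measurable_argmax fun i => (hψ i).1
  refine ⟨⟨Plan.stationary s hs, hk.planValue_stationary hv hs (fun z => ?_) z⟩, ?_⟩
  · rw [hloss, hs_max, sub_self]
  · rintro _ ⟨σ, rfl⟩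
    refine hk.planValue_le hv (fun i z => ?_) σ z
    rw [hloss]
    exact sub_nonneg.2 (le_vmax ψ i z)

lemma valueFun_eq_vmax (hk : IsDecisionWeight β r P k c) (hψ : ψ ∈ wBoundedProd N k)
    (hfix : jovanovicOp β r P ψ = ψ) : valueFun β r P = vmax ψ :=
  funext fun z => (hk.isGreatest_planValue hψ hfix z).csSup_eq

lemma eq_contValue (hk : IsDecisionWeight β r P k c) (hψ : ψ ∈ wBoundedProd N k)
    (hfix : jovanovicOp β r P ψ = ψ) : ψ = contValue β r P := by
  ext i z
  rw [contValue, hk.valueFun_eq_vmax hψ hfix]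
  exact (congrFun (congrFun hfix i) z).symm

end IsDecisionWeight

end Verification

section Weight

variable {Z : Type*} {N : ℕ} {r : Fin N → Z → ℝ} {g : Z → ℝ} {m' d' : ℝ}

lemma weight_pos (hg0 : ∀ z, 0 ≤ g z) (hm' : 0 ≤ m') (hd' : 0 < d') (z : Z) :
    0 < weight r g m' d' z := by
  have hsum : 0 ≤ m' * ∑ i, |r i z| :=
    mul_nonneg hm' (Finset.sum_nonneg fun i _ => abs_nonneg _)
  rw [weight]
  linarith [hg0 z]

variable [MeasurableSpace Z]

lemma integrable_and_integral_le_of_lintegral_ofReal_le {μ : Measure Z} {f : Z → ℝ}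
    (hf : Measurable f) (hf0 : ∀ z, 0 ≤ f z) {C : ℝ} (hC : 0 ≤ C)
    (hle : ∫⁻ z, ENNReal.ofReal (f z) ∂μ ≤ ENNReal.ofReal C) :
    Integrable f μ ∧ ∫ z, f z ∂μ ≤ C := by
  refine ⟨⟨hf.aestronglyMeasurable, ?_⟩, ?_⟩
  · rw [hasFiniteIntegral_iff_ofReal (ae_of_all _ hf0)]
    exact hle.trans_lt ENNReal.ofReal_lt_top
  · rw [integral_eq_lintegral_of_nonneg_ae (ae_of_all _ hf0) hf.aestronglyMeasurable]
    exact ENNReal.toReal_le_of_le_ofReal hC hle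

lemma measurable_weight (hr : ∀ i, Measurable (r i)) (hg : Measurable g) :
    Measurable (weight r g m' d') :=
  (((Finset.measurable_fun_sum _ fun i _ => (hr i).abs).const_mul m').add hg).add_const d'

section

variable {μ : Measure Z}

lemma integrable_weight [IsFiniteMeasure μ] (hr : ∀ i, Integrable (r i) μ) (hg : Integrable g μ) :
    Integrable (weight r g m' d') μ :=
  (((integrable_finsetSum _ fun i _ => (hr i).abs).const_mul m').add hg).add (integrable_const d')

lemma integral_weight [IsProbabilityMeasure μ] (hr : ∀ i, Integrable (r i) μ)
    (hg : Integrable g μ) :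
    ∫ z, weight r g m' d' z ∂μ = m' * ∑ i, ∫ z, |r i z| ∂μ + ∫ z, g z ∂μ + d' := by
  have hsum : Integrable (fun z => m' * ∑ i, |r i z|) μ :=
    (integrable_finsetSum _ fun i _ => (hr i).abs).const_mul m'
  have hsum_add : Integrable (fun z => m' * ∑ i, |r i z| + g z) μ := hsum.add hg
  simp only [weight]
  rw [integral_add hsum_add (integrable_const d'), integral_add hsum hg, integral_const_mul,
    integral_finsetSum _ fun i _ => (hr i).abs, integral_const, probReal_univ, one_smul]

end

lemma payoff_mem_wBoundedProd (hg0 : ∀ z, 0 ≤ g z) (hr : ∀ i, Measurable (r i)) (hm' : 0 < m')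
    (hd' : 0 < d') : r ∈ wBoundedProd N (weight r g m' d') := fun i => by
  refine (mem_wBounded_iff (weight_pos hg0 hm'.le hd')).2 ⟨hr i, m'⁻¹, fun z => ?_⟩
  have hsingle : |r i z| ≤ ∑ j, |r j z| :=
    Finset.single_le_sum (f := fun j => |r j z|) (fun j _ => abs_nonneg _) (Finset.mem_univ i)
  rw [← div_eq_inv_mul, le_div_iff₀' hm', weight]
  linarith [mul_le_mul_of_nonneg_left hsingle hm'.le, hg0 z]

lemma integral_weight_le {μ : Measure Z} [IsProbabilityMeasure μ] {m d : ℝ} {z : Z}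
    (hr : ∀ i, Integrable (r i) μ) (hg : Integrable g μ)
    (hr_le : ∀ i, ∫ z', |r i z'| ∂μ ≤ g z) (hg_le : ∫ z', g z' ∂μ ≤ m * g z + d)
    (hm' : 0 ≤ m') (hc : 0 ≤ N * m' + m) (hd : d ≤ d' * (N * m' + m - 1)) :
    ∫ z', weight r g m' d' z' ∂μ ≤ (N * m' + m) * weight r g m' d' z := by
  have hsum_le : ∑ i, ∫ z', |r i z'| ∂μ ≤ N * g z :=
    (Finset.sum_le_card_nsmul _ _ _ fun i _ => hr_le i).trans_eq (by simp)
  have hsum_nonneg : 0 ≤ m' * ∑ i, |r i z| :=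
    mul_nonneg hm' (Finset.sum_nonneg fun i _ => abs_nonneg _)
  calc ∫ z', weight r g m' d' z' ∂μ
      = m' * ∑ i, ∫ z', |r i z'| ∂μ + ∫ z', g z' ∂μ + d' := integral_weight hr hg
    _ ≤ m' * (N * g z) + (m * g z + d) + d' := by gcongr
    _ ≤ (N * m' + m) * (g z + d') := by linarith
    _ ≤ (N * m' + m) * weight r g m' d' z :=
        mul_le_mul_of_nonneg_left (by rw [weight]; linarith) hc

lemma isDriftWeight_weight {P : Fin N → Kernel Z Z} [∀ i, IsMarkovKernel (P i)] {m d : ℝ}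
    (hg0 : ∀ z, 0 ≤ g z) (hr : ∀ i, Measurable (r i)) (hg : Measurable g) (hm : 0 ≤ m) (hd : 0 ≤ d)
    (hbound : ∀ z i j, ∫⁻ z', ENNReal.ofReal |r i z'| ∂(P j z) ≤ ENNReal.ofReal (g z))
    (hdrift : ∀ z i, ∫⁻ z', ENNReal.ofReal (g z') ∂(P i z) ≤ ENNReal.ofReal (m * g z + d))
    (hm' : 0 < m') (hd' : 0 < d') (hdd : d ≤ d' * (N * m' + m - 1)) :
    IsDriftWeight P (weight r g m' d') (N * m' + m) := by
  have hc : 0 ≤ N * m' + m := by positivity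
  have hr_le : ∀ i j z, Integrable (fun z' => |r i z'|) (P j z) ∧ ∫ z', |r i z'| ∂(P j z) ≤ g z :=
    fun i j z => integrable_and_integral_le_of_lintegral_ofReal_le (hr i).abs
      (fun _ => abs_nonneg _) (hg0 z) (hbound z i j)
  have hr_int : ∀ i j z, Integrable (r i) (P j z) := fun i j z =>
    (integrable_norm_iff (hr i).aestronglyMeasurable).1 (hr_le i j z).1
  have hg_le : ∀ i z, Integrable g (P i z) ∧ ∫ z', g z' ∂(P i z) ≤ m * g z + d := fun i z =>
    integrable_and_integral_le_of_lintegral_ofReal_le hg hg0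
      (add_nonneg (mul_nonneg hm (hg0 z)) hd) (hdrift z i)
  exact
    { measurable := measurable_weight hr hg
      pos := weight_pos hg0 hm'.le hd'
      integrable := fun i z => integrable_weight (hr_int · i z) (hg_le i z).1
      integral_le := fun i z => integral_weight_le (hr_int · i z) (hg_le i z).1
        (fun j => (hr_le j i z).2) (hg_le i z).2 hm'.le hc hdd
      factor_nonneg := hc }

end Weight

end SeqDecision

open SeqDecision in
theorem mainTheorem3_general {Z : Type*} [MeasurableSpace Z] {N : ℕ} [NeZero N] {β : ℝ}
    {r : Fin N → Z → ℝ} {P : Fin N → Kernel Z Z} [∀ i, IsMarkovKernel (P i)] {k : Z → ℝ} {c : ℝ}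
    (hk : IsDecisionWeight β r P k c) :
    (∀ σ z, (∀ᵐ ω ∂(law P σ z), Summable fun t => payoff β r σ t ω) ∧
      Integrable (totalPayoff β r σ) (law P σ z)) ∧
    (∀ z, BddAbove (Set.range fun σ : Plan Z N => planValue β r P σ z)) ∧
    (∀ i z, Integrable (valueFun β r P) (P i z)) ∧
    valueFun β r P = vmax (contValue β r P) ∧
    (∀ ψ ∈ wBoundedProd N k, (∀ i z, Integrable (vmax ψ) (P i z)) ∧
      jovanovicOp β r P ψ ∈ wBoundedProd N k) ∧
    (∀ ψ ∈ wBoundedProd N k, ∀ φ ∈ wBoundedProd N k,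
      wdist k (jovanovicOp β r P ψ) (jovanovicOp β r P φ) ≤ β * c * wdist k ψ φ) ∧
    contValue β r P ∈ wBoundedProd N k ∧
    jovanovicOp β r P (contValue β r P) = contValue β r P ∧
    (∀ ψ ∈ wBoundedProd N k, jovanovicOp β r P ψ = ψ → ψ = contValue β r P) := by
  obtain ⟨ψ, hψ, hfix⟩ := hk.exists_fixedPoint
  have hv := hk.valueFun_eq_vmax hψ hfix
  obtain rfl := hk.eq_contValue hψ hfix
  exact ⟨hk.ae_summable_payoff_and_integrable_totalPayoff,
    fun z => (hk.isGreatest_planValue hψ hfix z).bddAbove,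
    fun i z => hv ▸ hk.integrable_vmax hψ i z, hv,
    fun φ hφ => ⟨hk.integrable_vmax hφ, hk.jovanovicOp_mem hk.payoff_mem hφ⟩,
    fun φ hφ χ hχ => hk.wdist_jovanovicOp_le hk.discount_nonneg hφ hχ, hψ, hfix,
    fun φ hφ h => hk.eq_contValue hφ h⟩

open SeqDecision in
theorem mainTheorem3 {Z : Type*} [MeasurableSpace Z] {N : ℕ} [NeZero N]
    (β : ℝ) (hβ0 : 0 < β) (hβ1 : β < 1)
    (r : Fin N → Z → ℝ) (hr : ∀ i, Measurable (r i))
    (P : Fin N → Kernel Z Z) [∀ i, IsMarkovKernel (P i)]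
    (g : Z → ℝ) (hg : Measurable g) (hg0 : ∀ z, 0 ≤ g z)
    (m d : ℝ) (hm : 0 ≤ m) (hd : 0 ≤ d) (hβm : β * m < 1)
    (hbound : ∀ z i j, ∫⁻ z', ENNReal.ofReal |r i z'| ∂(P j z) ≤ ENNReal.ofReal (g z))
    (hdrift : ∀ z i, ∫⁻ z', ENNReal.ofReal (g z') ∂(P i z) ≤ ENNReal.ofReal (m * g z + d))
    (m' d' : ℝ) (hm' : 0 < m') (hd' : 0 < d')
    (hgt : 1 < N * m' + m) (hlt : β * (N * m' + m) < 1)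
    (hdd : d / (N * m' + m - 1) ≤ d') :
    -- the value function is well defined
    (∀ σ z, (∀ᵐ ω ∂(law P σ z), Summable fun t => payoff β r σ t ω) ∧
      Integrable (totalPayoff β r σ) (law P σ z)) ∧
    (∀ z, BddAbove (Set.range fun σ : Plan Z N => planValue β r P σ z)) ∧
    (∀ i z, Integrable (valueFun β r P) (P i z)) ∧
    -- it is the maximum of the continuation values
    valueFun β r P = vmax (contValue β r P) ∧
    -- the operator is a well-defined self-map of the product space
    (∀ ψ ∈ wBoundedProd N (weight r g m' d'), (∀ i z, Integrable (vmax ψ) (P i z)) ∧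
      jovanovicOp β r P ψ ∈ wBoundedProd N (weight r g m' d')) ∧
    -- it is a contraction of modulus `β (N m' + m) < 1`
    (∀ ψ ∈ wBoundedProd N (weight r g m' d'), ∀ φ ∈ wBoundedProd N (weight r g m' d'),
      wdist (weight r g m' d') (jovanovicOp β r P ψ) (jovanovicOp β r P φ) ≤
        β * (N * m' + m) * wdist (weight r g m' d') ψ φ) ∧
    -- its unique fixed point is the vector of continuation values
    contValue β r P ∈ wBoundedProd N (weight r g m' d') ∧
    jovanovicOp β r P (contValue β r P) = contValue β r P ∧
    (∀ ψ ∈ wBoundedProd N (weight r g m' d'), jovanovicOp β r P ψ = ψ →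
      ψ = contValue β r P) :=
  have hd_le : d ≤ d' * (N * m' + m - 1) := (div_le_iff₀ (sub_pos.2 hgt)).1 hdd
  mainTheorem3_general
    ⟨isDriftWeight_weight hg0 hr hg hm hd hbound hdrift hm' hd' hd_le, hβ0.le, hlt,
      payoff_mem_wBoundedProd hg0 hr hm' hd'⟩
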